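/- Theorem. Let $\xi_1,\xi_2,\dots$ be a stochastic process with values in a measurable space $\Xi$, let $\mathcal F_t=\sigma(\xi_1,\dots,\xi_t)$, and assume that $\xi_{t+k}$ has a regular conditional distribution $P^{t+k}(\cdot\mid\mathcal F_t)$ given $\mathcal F_t$ for all $t,k\ge 1$. Let $\pi$ be a probability distribution on $\Xi$ (the stationary distribution), and let $$\beta(k)=\sup_{t\ge 1}\,2\,\mathbb E\big[d_{TV}\big(P^{t+k}(\cdot\mid\mathcal F_t),\pi\big)\big],\qquad d_{TV}(P,Q)=\sup_A|P(A)-Q(A)|.$$ Assume that $\pi$ and the law of every $\xi_t$ are absolutely continuous with respect to a measure $\nu$ on $\Xi$. Let $W$ be a compact subset of a real normed space with $\|v-w\|\le R$ for all $v,w\in W$, let $G\ge 0$, and let $F(w;x)$ be a loss, measurable in $x$ for each $w\in W$, such that for $\nu$-almost every $x$ the function $F(\cdot;x)$ is convex on $W$, satisfies $|F(v;x)-F(w;x)|\le G\|v-w\|$ for all $v,w\in W$, and takes values in $[0,GR]$ on $W$. Let $f(w)=\int F(w;x)\,d\pi(x)$, and assume that $f$ is $\sigma$-strongly convex over $W$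 for some $\sigma>0$, that is, $$f(v)\ge f(w)+\langle g,v-w\rangle+\tfrac{\sigma}{2}\|w-v\|^2\qquad\text{for all } v,w\in W \text{ and all } g\in\partial f(w),$$ where $\partial f(w)$ is the set of continuous linear functionals $g$ with $f(v)\ge f(w)+\langle g,v-w\rangle$ for all $v\in W$. Let $w^*\in\arg\min_{w\in W}f(w)$. An online algorithm plays points $w(1),w(2),\dots\in W$, where $w(t)$ is $\mathcal F_{t-1}$-measurable. Assume that it is stable: there is a (deterministic) non-increasing sequence $\kappa(t)$, $t\ge1$, with $\|w(t)-w(t+1)\|\le\kappa(t)$ almost surely for all $t\ge 1$. Let $\mathfrak R_n$ be a real random variable that bounds its regret: for every $v\in W$, almost surely $\sum_{t=1}^n[F(w(t);\xi_t)-F(v;\xi_t)]\le\mathfrak R_n$. Let $\widehat w_n=\frac1n\sum_{t=1}^n w(t)$. Then for every $\delta\in(0,1/e)$ and every integer $n\ge 3$, with probability greater than $1-5\delta\log n$, the following holds for every integer $\tau\ge 1$: $$f(\widehat w_n)-f(w^*)\le\frac2n\mathfrak R_n+\frac{2(\tau-1)G}{n}\Big(\sum_{t=1}^n\kappa(t)+2R\Big)+\frac{32G^2\tau}{\sigma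 n}\log\frac{\tau}{\delta}+\frac{12\tau RG}{n}\log\frac{2\tau}{\delta}+\frac{2RG\beta(\tau)}{\delta}.$$ -/

import Mathlib

open MeasureTheory ProbabilityTheory

namespace OnlineMixing

noncomputable section

/-- Total variation distance `sup_A |P(A) - Q(A)|`, the supremum over measurable sets. -/
def tvDist {Ξ : Type*} [MeasurableSpace Ξ] (P Q : Measure Ξ) : ℝ :=
  ⨆ A : {A : Set Ξ // MeasurableSet A}, |P.real (A : Set Ξ) - Q.real (A : Set Ξ)|

/-- The first `t` samples `(ξ₁, …, ξ_t)`. Samples are indexed from `1`; `ξ 0` is never used. -/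
def past {Ω Ξ : Type*} (ξ : ℕ → Ω → Ξ) (t : ℕ) (ω : Ω) : Fin t → Ξ :=
  fun i => ξ (i + 1) ω

/-- The σ-field `𝓕_t = σ(ξ₁, …, ξ_t)`; `𝓕₀` is trivial. -/
abbrev sampleSigma {Ω Ξ : Type*} [MeasurableSpace Ξ] (ξ : ℕ → Ω → Ξ) (t : ℕ) : MeasurableSpace Ω :=
  MeasurableSpace.comap (past ξ t) MeasurableSpace.pi

/-- The weak `β`-mixing coefficient
`β(k) = sup_{t ≥ 1} 2 𝔼[d_TV(P^{t+k}(· ∣ 𝓕_t), π)]`, where `P t k` is a version of the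
conditional distribution of `ξ_{t+k}` given `(ξ₁, …, ξ_t)`. The supremum is at most `2`, so
that `toReal` loses nothing. -/
def betaMixing {Ω Ξ : Type*} [MeasurableSpace Ω] [MeasurableSpace Ξ] (μ : Measure Ω)
    (ξ : ℕ → Ω → Ξ) (P : (t : ℕ) → ℕ → Kernel (Fin t → Ξ) Ξ) (π : Measure Ξ) (k : ℕ) : ℝ :=
  (⨆ t : {t : ℕ // 1 ≤ t},
    2 * ∫⁻ ω, ENNReal.ofReal (tvDist (P t k (past ξ t ω)) π) ∂μ).toReal

/-- The risk `f(w) = ∫ F(w; x) dπ(x)`. -/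
def risk {E Ξ : Type*} [MeasurableSpace Ξ] (F : E → Ξ → ℝ) (π : Measure Ξ) (w : E) : ℝ :=
  ∫ x, F w x ∂π

/-- The boundedness assumption: for `ν`-almost every `x`, the function `F(·; x)` is convex,
`G`-Lipschitz and `[0, G R]`-valued on `W`; the set `W` is compact, and any two of its points are
at distance at most `R`. -/
structure BoundedLoss {E Ξ : Type*} [NormedAddCommGroup E] [NormedSpace ℝ E] [MeasurableSpace Ξ]
    (W : Set E) (F : E → Ξ → ℝ) (ν : Measure Ξ) (G R : ℝ) : Prop where
  isCompact : IsCompact W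
  norm_sub_le : ∀ v ∈ W, ∀ w ∈ W, ‖v - w‖ ≤ R
  measurable : ∀ w ∈ W, Measurable (F w)
  convex : ∀ᵐ x ∂ν, ConvexOn ℝ W (fun w => F w x)
  lipschitz : ∀ᵐ x ∂ν, ∀ v ∈ W, ∀ w ∈ W, |F v x - F w x| ≤ G * ‖v - w‖
  mem_Icc : ∀ᵐ x ∂ν, ∀ w ∈ W, F w x ∈ Set.Icc 0 (G * R)

/-- The subdifferential at `w` of a function `f` on the domain `W`. -/
def subdifferential {E : Type*} [NormedAddCommGroup E] [NormedSpace ℝ E]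
    (W : Set E) (f : E → ℝ) (w : E) : Set (StrongDual ℝ E) :=
  {g | ∀ v ∈ W, f w + g (v - w) ≤ f v}

/-- `f` is `σ`-strongly convex over `W` with respect to the norm of `E`. -/
def IsStronglyConvex {E : Type*} [NormedAddCommGroup E] [NormedSpace ℝ E]
    (W : Set E) (f : E → ℝ) (σ : ℝ) : Prop :=
  ∀ w ∈ W, ∀ v ∈ W, ∀ g ∈ subdifferential W f w,
    f w + g (v - w) + σ / 2 * ‖w - v‖ ^ 2 ≤ f v

/-- An online algorithm on `W`: it plays the points `w 1, w 2, …` of `W`, and `w t` depends only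
on the first `t - 1` samples. -/
structure IsOnlineAlgorithm {Ω Ξ E : Type*} [MeasurableSpace Ξ] [MeasurableSpace E]
    (W : Set E) (ξ : ℕ → Ω → Ξ) (w : ℕ → Ω → E) : Prop where
  mem : ∀ t, 1 ≤ t → ∀ ω, w t ω ∈ W
  measurable : ∀ t, 1 ≤ t → Measurable[sampleSigma ξ (t - 1)] (w t)

/-- The stability assumption: `κ(1), κ(2), …` is non-increasing and bounds the distance of
successive iterates almost surely. -/
structure IsStable {Ω E : Type*} [MeasurableSpace Ω] [NormedAddCommGroup E]
    (μ : Measure Ω) (w : ℕ → Ω → E) (κ : ℕ → ℝ) : Prop where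
  antitone : AntitoneOn κ (Set.Ici 1)
  norm_sub_le : ∀ t, 1 ≤ t → ∀ᵐ ω ∂μ, ‖w t ω - w (t + 1) ω‖ ≤ κ t

/-- `Reg` bounds the regret of the first `n` iterates with respect to every fixed point of `W`. -/
def IsRegretBound {Ω Ξ E : Type*} [MeasurableSpace Ω] (μ : Measure Ω) (W : Set E)
    (F : E → Ξ → ℝ) (ξ : ℕ → Ω → Ξ) (w : ℕ → Ω → E) (n : ℕ) (Reg : Ω → ℝ) : Prop :=
  ∀ v ∈ W, ∀ᵐ ω ∂μ, ∑ t ∈ Finset.Icc 1 n, (F (w t ω) (ξ t ω) - F v (ξ t ω)) ≤ Reg ω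

/-- The averaged predictor `(1/n) ∑_{t=1}^n w(t)`. -/
def avgPredictor {Ω E : Type*} [NormedAddCommGroup E] [NormedSpace ℝ E]
    (w : ℕ → Ω → E) (n : ℕ) (ω : Ω) : E :=
  (1 / (n : ℝ)) • ∑ t ∈ Finset.Icc 1 n, w t ω

end

end OnlineMixing

/-!
The left side of the inequality, less `(2 / n) * Reg`, is a random variable that does not involve
the delay `τ`, while what remains on the right (`delayBound`) is a number depending on `τ`. The
failure events for the various `τ` are therefore nested, and uniformity in `τ` costs nothing
(`measure_exists_lt_le`): it is enough that each of them has probability at most `2 δ`, which is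
less than `5 δ log n` because `log n > 1`.

For a fixed `τ < n` the iterate `w (t + 1)`, known at time `t`, is paired with the sample
`ξ (t + τ)`. Given the first `t` samples, the excess loss `F (w (t + 1)) - F wstar` at `ξ (t + τ)`
lies within `G ‖w (t + 1) - wstar‖` of zero. By Hoeffding's lemma its centred version has an
exponential moment controlled by the square of that distance. Terms in one residue class of `t`
modulo `τ` are revealed one after the other, so the exponential moments multiply along the class;
a union bound over the `τ` classes costs probability `δ` (`measure_sum_gt_le`). The conditional
mean differs from the excess risk by at most `2 G R` times the total variation distance
between the conditional distribution and `π`; Markov's inequality bounds the sum of these biases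
outside another event of probability `δ` (`measure_excess_risk_deviation_le`).

Strong convexity gives `σ / 2 * ‖w (t + 1) - wstar‖ ^ 2 ≤ f (w (t + 1)) - f wstar`. With the
exponential parameter `σ / (2 G ^ 2)` the variance terms consume at most half of the excess risk,
and no peeling over the size of the variance is needed. Stability turns the delayed losses
into those appearing in the regret (`sum_le_of_delayed_losses`), and Jensen's inequality passes from
the iterates to their average.

The loss is first modified on a `ν`-null set so that its regularity holds at every sample point
(`BoundedLoss.exists_regularLoss`); this makes it jointly measurable and changes neither the risk
nor, almost surely, the regret.
-/

namespace OnlineMixing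

/-! ### Total variation and tail bounds -/

lemma abs_measureReal_sub_le_one {Ξ : Type*} [MeasurableSpace Ξ] (P Q : Measure Ξ)
    [IsProbabilityMeasure P] [IsProbabilityMeasure Q] (A : Set Ξ) :
    |P.real A - Q.real A| ≤ 1 :=
  abs_sub_le_of_nonneg_of_le measureReal_nonneg measureReal_le_one measureReal_nonneg
    measureReal_le_one

lemma tvDist_le_one {Ξ : Type*} [MeasurableSpace Ξ] (P Q : Measure Ξ)
    [IsProbabilityMeasure P] [IsProbabilityMeasure Q] : tvDist P Q ≤ 1 := by
  have : Nonempty {A : Set Ξ // MeasurableSet A} := ⟨⟨∅, MeasurableSet.empty⟩⟩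
  exact ciSup_le fun A => abs_measureReal_sub_le_one P Q A

/-- The positive part of a Hahn decomposition of `Q - P` realises the supremum in the definition
of the total variation distance. -/
lemma integral_sub_integral_le_mul_tvDist {Ξ : Type*} [MeasurableSpace Ξ] (P Q : Measure Ξ)
    [IsProbabilityMeasure P] [IsProbabilityMeasure Q] {h : Ξ → ℝ} (hm : Measurable h) {a b : ℝ}
    (hab : ∀ x, h x ∈ Set.Icc a b) :
    ∫ x, h x ∂Q - ∫ x, h x ∂P ≤ (b - a) * tvDist P Q := by
  obtain ⟨s, hs⟩ := exists_isHahnDecomposition P Q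
  have hint : ∀ (M : Measure Ξ) [IsFiniteMeasure M], Integrable h M := fun M _ =>
    Integrable.of_mem_Icc a b hm.aemeasurable (ae_of_all _ hab)
  -- on `s`, where `P ≤ Q`, the function is compared with its upper bound `b`
  have h1 : ∫ x in s, (b - h x) ∂P ≤ ∫ x in s, (b - h x) ∂Q :=
    integral_mono_measure hs.le_on (ae_of_all _ fun x => sub_nonneg.2 (hab x).2)
      ((integrable_const _).sub (hint _))
  -- on the complement, where `Q ≤ P`, it is compared with its lower bound `a`
  have h2 : ∫ x in sᶜ, (h x - a) ∂Q ≤ ∫ x in sᶜ, (h x - a) ∂P :=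
    integral_mono_measure hs.ge_on_compl (ae_of_all _ fun x => sub_nonneg.2 (hab x).1)
      ((hint _).sub (integrable_const _))
  rw [integral_sub (integrable_const _) (hint _), integral_sub (integrable_const _) (hint _)] at h1
  rw [integral_sub (hint _) (integrable_const _), integral_sub (hint _) (integrable_const _)] at h2
  simp only [setIntegral_const, smul_eq_mul] at h1 h2
  have h3 := integral_add_compl hs.measurableSet (hint P)
  have h4 := integral_add_compl hs.measurableSet (hint Q)
  have h5 : P.real sᶜ = 1 - P.real s := probReal_compl_eq_one_sub hs.measurableSet
  have h6 : Q.real sᶜ = 1 - Q.real s := probReal_compl_eq_one_sub hs.measurableSet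
  have h7 : |P.real s - Q.real s| ≤ tvDist P Q :=
    le_ciSup (f := fun A : {A : Set Ξ // MeasurableSet A} =>
      |P.real (A : Set Ξ) - Q.real (A : Set Ξ)|)
      ⟨1, Set.forall_mem_range.2 fun A => abs_measureReal_sub_le_one P Q A⟩ ⟨s, hs.measurableSet⟩
  have h8 : Q.real s - P.real s ≤ tvDist P Q :=
    le_trans (by rw [abs_sub_comm]; exact le_abs_self _) h7
  have hba : 0 ≤ b - a := by
    obtain ⟨x⟩ := nonempty_of_isProbabilityMeasure P
    linarith [(hab x).1, (hab x).2]
  rw [h5, h6] at h2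
  nlinarith [mul_le_mul_of_nonneg_left h8 hba]

/-- Markov's inequality in real form; a bound `c ≤ 0` is allowed, and then `f` vanishes almost
everywhere. -/
lemma measure_ofReal_div_lt_le {Ω : Type*} [MeasurableSpace Ω] {μ : Measure Ω}
    {f : Ω → ENNReal} (hf : Measurable f) {c δ : ℝ} (hδ : 0 < δ)
    (hc : ∫⁻ ω, f ω ∂μ ≤ ENNReal.ofReal c) :
    μ {ω | ENNReal.ofReal (c / δ) < f ω} ≤ ENNReal.ofReal δ := by
  rcases le_or_gt c 0 with h0 | h0
  · rw [ENNReal.ofReal_of_nonpos h0, nonpos_iff_eq_zero, lintegral_eq_zero_iff hf] at hc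
    refine le_trans (le_of_eq ?_) zero_le
    refine measure_mono_null (fun ω hω => ?_) (ae_iff.1 hc)
    exact (pos_of_gt hω).ne'
  · have h1 := (mul_meas_ge_le_lintegral hf (ENNReal.ofReal (c / δ))).trans hc
    have hpos : 0 < ENNReal.ofReal (c / δ) := ENNReal.ofReal_pos.2 (div_pos h0 hδ)
    have h2 : μ {ω | ENNReal.ofReal (c / δ) ≤ f ω}
        ≤ ENNReal.ofReal c / ENNReal.ofReal (c / δ) := by
      rw [ENNReal.le_div_iff_mul_le (Or.inl hpos.ne') (Or.inl ENNReal.ofReal_ne_top), mul_comm]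
      exact h1
    rw [← ENNReal.ofReal_div_of_pos (div_pos h0 hδ), div_div_cancel₀ h0.ne'] at h2
    refine le_trans (measure_mono fun ω hω => ?_) h2
    simp only [Set.mem_ofPred_eq] at hω ⊢
    exact hω.le

/-! ### Exponential supermartingales along arithmetic progressions -/

/-- Hoeffding's lemma, with the mean and the variance proxy moved into the exponent. -/
lemma lintegral_exp_integral_sub_le_one {Ξ : Type*} [MeasurableSpace Ξ] (Q : Measure Ξ)
    [IsProbabilityMeasure Q] {h : Ξ → ℝ} (hm : Measurable h) {c : ℝ} (hc : ∀ x, |h x| ≤ c)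
    (l : ℝ) :
    ∫⁻ y, ENNReal.ofReal (Real.exp (l * (∫ x, h x ∂Q - h y) - l ^ 2 * c ^ 2 / 2)) ∂Q ≤ 1 := by
  have hsub := hasSubgaussianMGF_of_mem_Icc (μ := Q) (a := -c) (b := c) hm.aemeasurable
    (ae_of_all _ fun x => abs_le.1 (hc x))
  have h1 := hsub.mgf_le (-l)
  have h2 := hsub.integrable_exp_mul (-l)
  have hcc : (((‖c - -c‖₊ / 2) ^ 2 : NNReal) : ℝ) = c ^ 2 := by
    simp only [NNReal.coe_pow, NNReal.coe_div, coe_nnnorm, NNReal.coe_ofNat, Real.norm_eq_abs]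
    rw [div_pow, sq_abs]; ring
  rw [hcc, mgf] at h1
  have h3 : ∀ y, Real.exp (l * (∫ x, h x ∂Q - h y) - l ^ 2 * c ^ 2 / 2)
      = Real.exp (-(l ^ 2 * c ^ 2 / 2)) * Real.exp (-l * (h y - ∫ x, h x ∂Q)) := fun y => by
    rw [← Real.exp_add]; congr 1; ring
  simp_rw [h3]
  rw [← ofReal_integral_eq_lintegral_ofReal (h2.const_mul _) (ae_of_all _ fun y => by positivity),
    integral_const_mul, ← ENNReal.ofReal_one]
  refine ENNReal.ofReal_le_ofReal ?_
  calc _ ≤ Real.exp (-(l ^ 2 * c ^ 2 / 2)) * Real.exp (c ^ 2 * (-l) ^ 2 / 2) := by gcongr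
    _ = 1 := by rw [← Real.exp_add, ← Real.exp_zero]; congr 1; ring

lemma lintegral_mul_comp_le_of_hasCondDistrib {Ω A B : Type*} [MeasurableSpace Ω]
    [MeasurableSpace A] [MeasurableSpace B] {μ : Measure Ω} [IsProbabilityMeasure μ]
    {X : Ω → A} {Y : Ω → B} {κ : Kernel A B} [IsMarkovKernel κ] (hc : HasCondDistrib Y X κ μ)
    (hX : Measurable X) {z : A → ENNReal} (hz : Measurable z) {u : A × B → ENNReal}
    (hu : Measurable u) (h1 : ∀ a, ∫⁻ y, u (a, y) ∂κ a ≤ 1) :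
    ∫⁻ ω, z (X ω) * u (X ω, Y ω) ∂μ ≤ ∫⁻ ω, z (X ω) ∂μ := by
  have : IsProbabilityMeasure (μ.map X) := Measure.isProbabilityMeasure_map hX.aemeasurable
  have hm : Measurable fun p : A × B => z p.1 * u p := by fun_prop
  calc ∫⁻ ω, z (X ω) * u (X ω, Y ω) ∂μ
      = ∫⁻ p, z p.1 * u p ∂(μ.map fun ω => (X ω, Y ω)) :=
        (lintegral_map' hm.aemeasurable (HasLaw.aemeasurable hc)).symm
    _ = ∫⁻ a, ∫⁻ y, z a * u (a, y) ∂κ a ∂(μ.map X) := by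
        rw [HasLaw.map_eq hc, Measure.lintegral_compProd hm]
    _ ≤ ∫⁻ a, z a ∂(μ.map X) := by
        refine lintegral_mono fun a => ?_
        rw [lintegral_const_mul _ (by fun_prop)]
        exact (mul_le_mul_right (h1 a) _).trans (mul_one _).le
    _ = ∫⁻ ω, z (X ω) ∂μ := lintegral_map hz hX

/-- If `U t` becomes known only at time `t + τ`, but multiplying by `exp (U t)` does not increase
the expectation of quantities known at time `t`, then the partial sums of `U` along a residue
class modulo `τ` have exponential moment at most one: in such a class every term is known when
the next one starts. -/
lemma lintegral_exp_sum_residue_le_one {Ω : Type*} [mΩ : MeasurableSpace Ω] {μ : Measure Ω}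
    [IsProbabilityMeasure μ] {𝓕 : ℕ → MeasurableSpace Ω} (hmono : Monotone 𝓕) {τ : ℕ}
    {U : ℕ → Ω → ℝ} (hU : ∀ t, 1 ≤ t → Measurable[𝓕 (t + τ)] (U t))
    (hstep : ∀ t, 1 ≤ t → ∀ Z : Ω → ENNReal, Measurable[𝓕 t] Z →
      ∫⁻ ω, Z ω * ENNReal.ofReal (Real.exp (U t ω)) ∂μ ≤ ∫⁻ ω, Z ω ∂μ) (r N : ℕ) :
    ∫⁻ ω, ENNReal.ofReal (Real.exp (∑ t ∈ (Finset.Icc 1 N).filter (fun t => t % τ = r), U t ω)) ∂μ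
      ≤ 1 := by
  induction N with
  | zero => simp
  | succ N ih =>
    rw [← Finset.insert_Icc_right_eq_Icc_add_one (by omega), Finset.filter_insert]
    split_ifs with hr
    · refine le_trans ?_ ih
      have hnot : N + 1 ∉ (Finset.Icc 1 N).filter (fun t => t % τ = r) := by simp
      have hZ : Measurable[𝓕 (N + 1)] fun ω => ENNReal.ofReal
          (Real.exp (∑ t ∈ (Finset.Icc 1 N).filter (fun t => t % τ = r), U t ω)) := by
        refine ENNReal.measurable_ofReal.comp (Real.measurable_exp.comp ?_)
        refine Finset.measurable_fun_sum _ fun t ht => ?_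
        simp only [Finset.mem_filter, Finset.mem_Icc] at ht
        refine (hU t ht.1.1).mono (hmono ?_) le_rfl
        -- two distinct members of a residue class are at least `τ` apart
        have hmod : t ≡ N + 1 [MOD τ] := ht.2.trans hr.symm
        have := Nat.le_of_dvd (by omega) ((Nat.modEq_iff_dvd' (by omega)).1 hmod)
        omega
      refine le_trans (le_of_eq (lintegral_congr fun ω => ?_)) (hstep (N + 1) (by omega) _ hZ)
      rw [Finset.sum_insert hnot, add_comm, Real.exp_add,
        ENNReal.ofReal_mul (Real.exp_pos _).le]
    · exact ih

/-- Union bound over the residue classes modulo `τ`, each of which exceeds `log (τ / δ)` with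
probability at most `δ / τ`. -/
lemma measure_sum_gt_le {Ω : Type*} [mΩ : MeasurableSpace Ω] {μ : Measure Ω}
    [IsProbabilityMeasure μ] {𝓕 : ℕ → MeasurableSpace Ω} (hmono : Monotone 𝓕)
    (hle : ∀ t, 𝓕 t ≤ mΩ) {τ : ℕ} (hτ : 1 ≤ τ)
    {U : ℕ → Ω → ℝ} (hU : ∀ t, 1 ≤ t → Measurable[𝓕 (t + τ)] (U t))
    (hstep : ∀ t, 1 ≤ t → ∀ Z : Ω → ENNReal, Measurable[𝓕 t] Z →
      ∫⁻ ω, Z ω * ENNReal.ofReal (Real.exp (U t ω)) ∂μ ≤ ∫⁻ ω, Z ω ∂μ) (N : ℕ)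
    {δ : ℝ} (hδ : 0 < δ) :
    μ {ω | τ * Real.log (τ / δ) < ∑ t ∈ Finset.Icc 1 N, U t ω} ≤ ENNReal.ofReal δ := by
  have hτ0 : (0 : ℝ) < τ := by exact_mod_cast hτ
  have hblock : ∀ r, μ {ω | Real.log (τ / δ)
      < ∑ t ∈ (Finset.Icc 1 N).filter (fun t => t % τ = r), U t ω}
      ≤ ENNReal.ofReal (δ / τ) := fun r => by
    have hm : Measurable fun ω => ENNReal.ofReal
        (Real.exp (∑ t ∈ (Finset.Icc 1 N).filter (fun t => t % τ = r), U t ω)) := by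
      refine ENNReal.measurable_ofReal.comp (Real.measurable_exp.comp ?_)
      refine Finset.measurable_fun_sum _ fun t ht => ?_
      simp only [Finset.mem_filter, Finset.mem_Icc] at ht
      exact (hU t ht.1.1).mono (hle _) le_rfl
    have h1 := measure_ofReal_div_lt_le (c := 1) (δ := δ / τ) hm (by positivity)
      ((lintegral_exp_sum_residue_le_one hmono hU hstep r N).trans_eq ENNReal.ofReal_one.symm)
    refine (measure_mono fun ω hω => ?_).trans h1
    rw [Set.mem_ofPred] at hω ⊢
    rw [ENNReal.ofReal_lt_ofReal_iff (Real.exp_pos _), one_div_div]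
    exact (Real.log_lt_iff_lt_exp (by positivity)).1 hω
  calc μ {ω | τ * Real.log (τ / δ) < ∑ t ∈ Finset.Icc 1 N, U t ω}
      ≤ μ (⋃ r ∈ Finset.range τ, {ω | Real.log (τ / δ)
          < ∑ t ∈ (Finset.Icc 1 N).filter (fun t => t % τ = r), U t ω}) := by
        refine measure_mono fun ω hω => ?_
        by_contra hcon
        simp only [Set.mem_iUnion, Set.mem_ofPred_eq, not_exists, not_lt] at hcon hω
        have hfib := Finset.sum_fiberwise_of_maps_to (s := Finset.Icc 1 N) (t := Finset.range τ)
          (g := fun t => t % τ) (fun t _ => Finset.mem_range.2 (Nat.mod_lt _ hτ))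
          (fun t => U t ω)
        have hle' := Finset.sum_le_sum fun r hr => hcon r hr
        rw [hfib, Finset.sum_const, Finset.card_range, nsmul_eq_mul] at hle'
        exact absurd hω hle'.not_gt
    _ ≤ ∑ r ∈ Finset.range τ, ENNReal.ofReal (δ / τ) :=
        (measure_biUnion_finset_le _ _).trans (Finset.sum_le_sum fun r _ => hblock r)
    _ = ENNReal.ofReal δ := by
        rw [Finset.sum_const, Finset.card_range, nsmul_eq_mul, ← ENNReal.ofReal_natCast,
          ← ENNReal.ofReal_mul hτ0.le, mul_div_cancel₀ _ hτ0.ne']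

/-! ### Filtration and mixing coefficient -/

lemma sampleSigma_mono {Ω Ξ : Type*} [MeasurableSpace Ξ] (ξ : ℕ → Ω → Ξ) :
    Monotone (sampleSigma ξ) := by
  intro s t hst
  have h : past ξ s = (fun a i => a (Fin.castLE hst i)) ∘ past ξ t := rfl
  rw [sampleSigma, h, ← MeasurableSpace.comap_comp]
  exact MeasurableSpace.comap_mono (Measurable.comap_le (by fun_prop))

lemma measurable_past {Ω Ξ : Type*} [MeasurableSpace Ω] [MeasurableSpace Ξ] {ξ : ℕ → Ω → Ξ}
    (hξ : ∀ t, 1 ≤ t → Measurable (ξ t)) (t : ℕ) : Measurable (past ξ t) :=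
  measurable_pi_lambda _ fun i => hξ _ (by omega)

lemma measurable_sampleSigma_self {Ω Ξ : Type*} [MeasurableSpace Ξ] (ξ : ℕ → Ω → Ξ) {t : ℕ}
    (ht : 1 ≤ t) : Measurable[sampleSigma ξ t] (ξ t) := by
  have h : ξ t = (fun a : Fin t → Ξ => a ⟨t - 1, by omega⟩) ∘ past ξ t := by
    ext ω
    simp [past, Nat.sub_add_cancel ht]
  rw [h]
  exact (measurable_pi_apply _).comp (comap_measurable _)

lemma two_mul_lintegral_tvDist_le {Ω Ξ : Type*} [MeasurableSpace Ω] [MeasurableSpace Ξ]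
    (μ : Measure Ω) [IsProbabilityMeasure μ] (ξ : ℕ → Ω → Ξ)
    (P : (t : ℕ) → ℕ → Kernel (Fin t → Ξ) Ξ) [∀ t k, IsMarkovKernel (P t k)]
    (π : Measure Ξ) [IsProbabilityMeasure π] (k : ℕ) {t : ℕ} (ht : 1 ≤ t) :
    2 * ∫⁻ ω, ENNReal.ofReal (tvDist (P t k (past ξ t ω)) π) ∂μ
      ≤ ENNReal.ofReal (betaMixing μ ξ P π k) := by
  have hfin : (⨆ t : {t : ℕ // 1 ≤ t},
      2 * ∫⁻ ω, ENNReal.ofReal (tvDist (P t k (past ξ t ω)) π) ∂μ) ≠ ⊤ := by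
    refine ne_top_of_le_ne_top (b := 2) (by simp) (iSup_le fun s => ?_)
    calc 2 * ∫⁻ ω, ENNReal.ofReal (tvDist (P s k (past ξ s ω)) π) ∂μ
        ≤ 2 * ∫⁻ _, 1 ∂μ := by
          gcongr with ω
          exact ENNReal.ofReal_le_one.2 (tvDist_le_one _ _)
      _ = 2 := by simp
  rw [betaMixing, ENNReal.ofReal_toReal hfin]
  exact le_iSup (fun t : {t : ℕ // 1 ≤ t} =>
    2 * ∫⁻ ω, ENNReal.ofReal (tvDist (P t k (past ξ t ω)) π) ∂μ) ⟨t, ht⟩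

/-! ### Losses that are regular at every sample point -/

/-- The assumptions of `BoundedLoss` at every sample point, not merely almost every one. -/
structure RegularLoss {E Ξ : Type*} [NormedAddCommGroup E] [NormedSpace ℝ E] [MeasurableSpace Ξ]
    (W : Set E) (F : E → Ξ → ℝ) (G R : ℝ) : Prop where
  isCompact : IsCompact W
  norm_sub_le : ∀ v ∈ W, ∀ w ∈ W, ‖v - w‖ ≤ R
  measurable : ∀ w ∈ W, Measurable (F w)
  convex : ∀ x, ConvexOn ℝ W (fun w => F w x)
  lipschitz : ∀ x, ∀ v ∈ W, ∀ w ∈ W, |F v x - F w x| ≤ G * ‖v - w‖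
  mem_Icc : ∀ x, ∀ w ∈ W, F w x ∈ Set.Icc 0 (G * R)

section Loss

variable {E Ξ : Type*} [NormedAddCommGroup E] [NormedSpace ℝ E] [MeasurableSpace Ξ]
  {W : Set E} {F : E → Ξ → ℝ} {G R : ℝ}

/-- Setting the loss to zero on a measurable null set containing the exceptional points makes it
regular everywhere. -/
lemma BoundedLoss.exists_regularLoss {ν : Measure Ξ} (hF : BoundedLoss W F ν G R) (hG : 0 ≤ G)
    (hν : ν ≠ 0) :
    ∃ F' : E → Ξ → ℝ, RegularLoss W F' G R ∧ ∀ᵐ x ∂ν, ∀ w, F' w x = F w x := by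
  classical
  have : NeZero ν := ⟨hν⟩
  have hall := hF.convex.and (hF.lipschitz.and hF.mem_Icc)
  obtain ⟨s, hs, hsm, hs0⟩ := exists_measurable_superset_of_null (ae_iff.1 hall)
  have hgood : ∀ x, x ∉ s → ConvexOn ℝ W (fun w => F w x) ∧
      (∀ v ∈ W, ∀ w ∈ W, |F v x - F w x| ≤ G * ‖v - w‖) ∧
      ∀ w ∈ W, F w x ∈ Set.Icc 0 (G * R) := fun x hx => by
    by_contra h
    exact hx (hs h)
  obtain ⟨x₀, hx₀⟩ := hF.convex.exists
  refine ⟨fun w x => if x ∈ s then 0 else F w x, ⟨hF.isCompact, hF.norm_sub_le, fun w hw => ?_,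
    fun x => ?_, fun x v hv w hw => ?_, fun x w hw => ?_⟩, ?_⟩
  · exact Measurable.ite hsm measurable_const (hF.measurable w hw)
  · by_cases hx : x ∈ s
    · simpa [hx] using convexOn_const (0 : ℝ) hx₀.1
    · simpa [hx] using (hgood x hx).1
  · by_cases hx : x ∈ s
    · simpa [hx] using mul_nonneg hG (norm_nonneg _)
    · simpa [hx] using (hgood x hx).2.1 v hv w hw
  · by_cases hx : x ∈ s
    · simpa [hx] using mul_nonneg hG ((norm_nonneg _).trans (hF.norm_sub_le w hw w hw))
    · simpa [hx] using (hgood x hx).2.2 w hw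
  · filter_upwards [measure_eq_zero_iff_ae_notMem.1 hs0] with x hx w
    simp [hx]

namespace RegularLoss

variable (hF : RegularLoss W F G R)
include hF

lemma integrable {w : E} (hw : w ∈ W) (M : Measure Ξ) [IsFiniteMeasure M] :
    Integrable (F w) M :=
  Integrable.of_mem_Icc 0 (G * R) (hF.measurable w hw).aemeasurable
    (ae_of_all _ fun x => hF.mem_Icc x w hw)

lemma risk_mem_Icc (π : Measure Ξ) [IsProbabilityMeasure π] {w : E} (hw : w ∈ W) :
    risk F π w ∈ Set.Icc 0 (G * R) := by
  refine ⟨integral_nonneg fun x => (hF.mem_Icc x w hw).1, ?_⟩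
  refine (integral_mono (hF.integrable hw π) (integrable_const (G * R))
    fun x => (hF.mem_Icc x w hw).2).trans_eq ?_
  simp

lemma convexOn_risk (π : Measure Ξ) [IsProbabilityMeasure π] : ConvexOn ℝ W (risk F π) := by
  obtain ⟨x₀⟩ := nonempty_of_isProbabilityMeasure π
  refine ⟨(hF.convex x₀).1, fun v hv w hw a b ha hb hab => ?_⟩
  have hmem := (hF.convex x₀).1 hv hw ha hb hab
  simp only [risk, smul_eq_mul]
  rw [← integral_const_mul, ← integral_const_mul, ← integral_add
    ((hF.integrable hv π).const_mul a) ((hF.integrable hw π).const_mul b)]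
  exact integral_mono (hF.integrable hmem π)
    (((hF.integrable hv π).const_mul a).add ((hF.integrable hw π).const_mul b))
    fun x => (hF.convex x).2 hv hw ha hb hab

/-- A function that is measurable in `x` and continuous on the compact set `W` is jointly
measurable. -/
lemma measurable_uncurry [MeasurableSpace E] [BorelSpace E] :
    Measurable fun p : W × Ξ => F p.1 p.2 := by
  have : CompactSpace W := isCompact_iff_compactSpace.1 hF.isCompact
  refine measurable_uncurry_of_continuous_of_measurable (u := fun (v : W) x => F v x)
    (fun x => ?_) fun v => hF.measurable v v.2
  refine (LipschitzWith.of_dist_le_mul (K := G.toNNReal) fun v w => ?_).continuous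
  rw [Real.dist_eq, Subtype.dist_eq, dist_eq_norm]
  refine (hF.lipschitz x v v.2 w w.2).trans ?_
  gcongr
  exact Real.le_coe_toNNReal G

end RegularLoss

/-- A minimizer has zero as a subgradient, so that strong convexity gives quadratic growth. -/
lemma IsStronglyConvex.sq_norm_sub_le {f : E → ℝ} {σ : ℝ} (hf : IsStronglyConvex W f σ)
    {wstar : E} (hwstar : wstar ∈ W) (hmin : IsMinOn f W wstar) {v : E} (hv : v ∈ W) :
    σ / 2 * ‖v - wstar‖ ^ 2 ≤ f v - f wstar := by
  have h := hf wstar hwstar v hv 0 fun u hu => by simpa using hmin hu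
  rw [norm_sub_rev] at h
  simp only [zero_apply, add_zero] at h
  linarith

end Loss

/-- The Doob–Dynkin lemma for the iterates; compactness of `W` makes it a standard Borel space even
though `E` need be neither complete nor separable. -/
lemma IsOnlineAlgorithm.exists_measurable_comp_past {Ω Ξ E : Type*} [MeasurableSpace Ξ]
    [NormedAddCommGroup E] [MeasurableSpace E] [BorelSpace E] {W : Set E} (hW : IsCompact W)
    (hne : W.Nonempty) {ξ : ℕ → Ω → Ξ} {w : ℕ → Ω → E} (hw : IsOnlineAlgorithm W ξ w) (t : ℕ) :
    ∃ g : (Fin t → Ξ) → W, Measurable g ∧ ∀ ω, w (t + 1) ω = g (past ξ t ω) := by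
  have : CompactSpace W := isCompact_iff_compactSpace.1 hW
  have : Nonempty W := hne.to_subtype
  have hm : Measurable[sampleSigma ξ t] fun ω => (⟨w (t + 1) ω, hw.mem _ (by omega) ω⟩ : W) :=
    Measurable.subtype_mk (hw.measurable (t + 1) (by omega))
  obtain ⟨g, hg, hgw⟩ := hm.exists_eq_measurable_comp
  exact ⟨g, hg, fun ω => congrArg Subtype.val (congrFun hgw ω)⟩

/-! ### Deviation of the risk from the delayed losses -/

/-- The iterate `w (t + 1)` is compared with the sample `ξ (t + τ)`, whose conditional
distribution given the first `t` samples is within the mixing coefficient of `π` on average. The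
excess risk exceeds the excess loss at that sample by a conditionally centred term, handled by the
exponential moment bound at parameter `l`, and a bias, handled by Markov's inequality. -/
lemma measure_excess_risk_deviation_le
    {Ω Ξ E : Type*} [MeasurableSpace Ω] [MeasurableSpace Ξ]
    [NormedAddCommGroup E] [NormedSpace ℝ E] [MeasurableSpace E] [BorelSpace E]
    (μ : Measure Ω) [IsProbabilityMeasure μ]
    {ξ : ℕ → Ω → Ξ} (hξ : ∀ t, 1 ≤ t → Measurable (ξ t))
    (P : (t : ℕ) → ℕ → Kernel (Fin t → Ξ) Ξ) [∀ t k, IsMarkovKernel (P t k)]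
    (hP : ∀ t k, 1 ≤ t → 1 ≤ k → HasCondDistrib (ξ (t + k)) (past ξ t) (P t k) μ)
    (π : Measure Ξ) [IsProbabilityMeasure π]
    {W : Set E} {F : E → Ξ → ℝ} {G R : ℝ} (hG : 0 ≤ G) (hF : RegularLoss W F G R)
    {w : ℕ → Ω → E} (hw : IsOnlineAlgorithm W ξ w) {wstar : E} (hwstar : wstar ∈ W)
    {τ : ℕ} (hτ : 1 ≤ τ) (N : ℕ) {δ l : ℝ} (hδ : 0 < δ) (hl : 0 < l) :
    μ {ω | τ * Real.log (τ / δ) / l + N * (G * R * betaMixing μ ξ P π τ) / δ <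
      ∑ t ∈ Finset.Icc 1 N, (risk F π (w (t + 1) ω) - risk F π wstar
        - (F (w (t + 1) ω) (ξ (t + τ) ω) - F wstar (ξ (t + τ) ω))
        - l * G ^ 2 * ‖w (t + 1) ω - wstar‖ ^ 2 / 2)} ≤ ENNReal.ofReal (2 * δ) := by
  have hR : 0 ≤ R := (norm_nonneg _).trans (hF.norm_sub_le _ hwstar _ hwstar)
  choose g hg hgw using
    fun t => hw.exists_measurable_comp_past hF.isCompact ⟨wstar, hwstar⟩ t
  -- excess loss, conditional mean, squared distance and bias as functions of the past
  let h : (t : ℕ) → (Fin t → Ξ) → Ξ → ℝ := fun t a x => F (g t a) x - F wstar x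
  let m : (t : ℕ) → (Fin t → Ξ) → ℝ := fun t a => ∫ x, h t a x ∂P t τ a
  let b : (t : ℕ) → (Fin t → Ξ) → ℝ := fun t a => ∫ x, h t a x ∂π - m t a
  let U : ℕ → Ω → ℝ := fun t ω => l * (m t (past ξ t ω) - h t (past ξ t ω) (ξ (t + τ) ω))
    - l ^ 2 * (G * ‖(g t (past ξ t ω) : E) - wstar‖) ^ 2 / 2
  have hh : ∀ t, Measurable (Function.uncurry (h t)) := fun t =>
    (hF.measurable_uncurry.comp (((hg t).comp measurable_fst).prodMk measurable_snd)).sub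
      ((hF.measurable _ hwstar).comp measurable_snd)
  have hm : ∀ t, Measurable (m t) := fun t =>
    ((hh t).stronglyMeasurable.integral_kernel_prod_right (κ := P t τ)).measurable
  have hb : ∀ t, Measurable (b t) := fun t =>
    ((hh t).stronglyMeasurable.integral_prod_right (ν := π)).measurable.sub (hm t)
  have hd : ∀ t, Measurable fun a => ‖(g t a : E) - wstar‖ := fun t => by
    have hc : Continuous fun v : W => ‖(v : E) - wstar‖ := by fun_prop
    exact hc.measurable.comp (hg t)
  have hu : ∀ t, Measurable fun p : (Fin t → Ξ) × Ξ =>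
      l * (m t p.1 - h t p.1 p.2) - l ^ 2 * (G * ‖(g t p.1 : E) - wstar‖) ^ 2 / 2 := fun t => by
    have h1 : Measurable fun p : (Fin t → Ξ) × Ξ => h t p.1 p.2 := hh t
    have h2 : Measurable fun p : (Fin t → Ξ) × Ξ => m t p.1 := (hm t).comp measurable_fst
    have h3 : Measurable fun p : (Fin t → Ξ) × Ξ => ‖(g t p.1 : E) - wstar‖ :=
      (hd t).comp measurable_fst
    exact ((h2.sub h1).const_mul l).sub ((((h3.const_mul G).pow_const 2).const_mul _).div_const 2)
  have habs : ∀ t a x, |h t a x| ≤ G * ‖(g t a : E) - wstar‖ := fun t a x =>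
    hF.lipschitz x _ (g t a).2 _ hwstar
  have hle : ∀ t, sampleSigma ξ t ≤ ‹MeasurableSpace Ω› := fun t =>
    (measurable_past hξ t).comap_le
  have hUm : ∀ t, 1 ≤ t → Measurable[sampleSigma ξ (t + τ)] (U t) := fun t ht => by
    have h1 : Measurable[sampleSigma ξ (t + τ)] (past ξ t) :=
      (comap_measurable _).mono (sampleSigma_mono ξ (Nat.le_add_right t τ)) le_rfl
    exact (hu t).comp (h1.prodMk (measurable_sampleSigma_self ξ (by omega)))
  have hstep : ∀ t, 1 ≤ t → ∀ Z : Ω → ENNReal, Measurable[sampleSigma ξ t] Z →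
      ∫⁻ ω, Z ω * ENNReal.ofReal (Real.exp (U t ω)) ∂μ ≤ ∫⁻ ω, Z ω ∂μ := fun t ht Z hZ => by
    obtain ⟨z, hz, rfl⟩ := hZ.exists_eq_measurable_comp
    exact lintegral_mul_comp_le_of_hasCondDistrib (hP t τ ht hτ) (measurable_past hξ t) hz
      (ENNReal.measurable_ofReal.comp (Real.measurable_exp.comp (hu t)))
      fun a => lintegral_exp_integral_sub_le_one (P t τ a)
        ((hh t).comp measurable_prodMk_left) (habs t a) l
  have hdev := measure_sum_gt_le (sampleSigma_mono ξ) hle hτ hUm hstep N hδ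
  have hbias : ∀ t, 1 ≤ t → ∫⁻ ω, ENNReal.ofReal (b t (past ξ t ω)) ∂μ
      ≤ ENNReal.ofReal (G * R * betaMixing μ ξ P π τ) := fun t ht => by
    have hb' : ∀ a, b t a ≤ (2 * (G * R)) * tvDist (P t τ a) π := fun a => by
      have hbound : ∀ x, h t a x ∈ Set.Icc (-(G * R)) (G * R) := fun x =>
        abs_le.1 ((habs t a x).trans
          (mul_le_mul_of_nonneg_left (hF.norm_sub_le _ (g t a).2 _ hwstar) hG))
      refine (integral_sub_integral_le_mul_tvDist (P t τ a) π
        ((hh t).comp measurable_prodMk_left) hbound).trans_eq ?_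
      ring
    calc ∫⁻ ω, ENNReal.ofReal (b t (past ξ t ω)) ∂μ
        ≤ ∫⁻ ω, ENNReal.ofReal (G * R) *
            (2 * ENNReal.ofReal (tvDist (P t τ (past ξ t ω)) π)) ∂μ := by
          refine lintegral_mono fun ω => ?_
          refine (ENNReal.ofReal_le_ofReal (hb' _)).trans_eq ?_
          rw [ENNReal.ofReal_mul (by positivity), ENNReal.ofReal_mul (by norm_num),
            ENNReal.ofReal_ofNat]
          ring
      _ = ENNReal.ofReal (G * R) *
            (2 * ∫⁻ ω, ENNReal.ofReal (tvDist (P t τ (past ξ t ω)) π) ∂μ) := by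
          rw [lintegral_const_mul' _ _ ENNReal.ofReal_ne_top, lintegral_const_mul' _ _ (by simp)]
      _ ≤ ENNReal.ofReal (G * R * betaMixing μ ξ P π τ) := by
          rw [ENNReal.ofReal_mul (p := G * R) (by positivity)]
          exact mul_le_mul_right (two_mul_lintegral_tvDist_le μ ξ P π τ ht) _
  have hmarkov : μ {ω | ENNReal.ofReal (N * (G * R * betaMixing μ ξ P π τ) / δ) <
      ∑ t ∈ Finset.Icc 1 N, ENNReal.ofReal (b t (past ξ t ω))} ≤ ENNReal.ofReal δ := by
    have hmt : ∀ t, Measurable fun ω => ENNReal.ofReal (b t (past ξ t ω)) := fun t =>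
      ENNReal.measurable_ofReal.comp ((hb t).comp (measurable_past hξ t))
    refine measure_ofReal_div_lt_le (Finset.measurable_fun_sum _ fun t _ => hmt t) hδ ?_
    rw [lintegral_finsetSum _ fun t _ => hmt t]
    refine (Finset.sum_le_sum fun t ht => hbias t (Finset.mem_Icc.1 ht).1).trans_eq ?_
    rw [Finset.sum_const, Nat.card_Icc, nsmul_eq_mul, ← ENNReal.ofReal_natCast,
      ← ENNReal.ofReal_mul (by positivity), Nat.add_sub_cancel]
  rw [two_mul, ENNReal.ofReal_add hδ.le hδ.le]
  refine le_trans (measure_mono fun ω hω => ?_)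
    ((measure_union_le _ _).trans (add_le_add hdev hmarkov))
  rw [Set.mem_union, Set.mem_ofPred, Set.mem_ofPred]
  rw [Set.mem_ofPred] at hω
  by_contra! hcon
  obtain ⟨hcon1, hcon2⟩ := hcon
  have hbnn : 0 ≤ betaMixing μ ξ P π τ := ENNReal.toReal_nonneg
  have hsum := (Finset.le_sum_of_subadditive ENNReal.ofReal ENNReal.ofReal_zero.le
    (fun x y => ENNReal.ofReal_add_le) (Finset.Icc 1 N) fun t => b t (past ξ t ω)).trans hcon2
  rw [ENNReal.ofReal_le_ofReal_iff (by positivity)] at hsum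
  rw [← div_le_div_iff_of_pos_right hl, Finset.sum_div] at hcon1
  refine absurd hω (not_lt.2 (le_trans (le_of_eq ?_) (add_le_add hcon1 hsum)))
  rw [← Finset.sum_add_distrib]
  refine Finset.sum_congr rfl fun t _ => ?_
  have hπ : ∫ x, h t (past ξ t ω) x ∂π = risk F π (w (t + 1) ω) - risk F π wstar := by
    rw [hgw]
    exact integral_sub (hF.integrable (g t _).2 π) (hF.integrable hwstar π)
  simp only [b, U, hπ]
  simp only [h, hgw]
  field_simp
  ring

/-! ### From delayed losses to the regret -/

lemma sum_Icc_one_add (c : ℕ → ℝ) (N k : ℕ) :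
    ∑ t ∈ Finset.Icc 1 (N + k), c t
      = ∑ t ∈ Finset.Icc 1 k, c t + ∑ t ∈ Finset.Icc 1 N, c (t + k) := by
  induction N with
  | zero => simp
  | succ N ih =>
    rw [show N + 1 + k = N + k + 1 by ring, Finset.sum_Icc_succ_top (by omega),
      Finset.sum_Icc_succ_top (by omega), ih, show N + 1 + k = N + k + 1 by ring]
    ring

/-- Bookkeeping for a delay of `s + 1`: replacing the delayed losses `y` by the losses `c` costs
the drift of the iterates, and the at most `s + 1` terms without a counterpart on either side cost
`C` each. -/
lemma sum_le_of_delayed_losses {C G A : ℝ} {κ D c y : ℕ → ℝ} {N s : ℕ} (hG : 0 ≤ G)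
    (hκ : ∀ t, 1 ≤ t → 0 ≤ κ t) (hD : ∀ t, 1 ≤ t → D t ≤ C) (hc : ∀ t, 1 ≤ t → -C ≤ c t)
    (hy : ∀ t, 1 ≤ t → y t ≤ c (t + (s + 1)) + G * ∑ i ∈ Finset.range s, κ (t + 1 + i))
    (hA : ∑ t ∈ Finset.Icc 1 N, (D (t + 1) / 2 - y t) ≤ A) :
    ∑ t ∈ Finset.Icc 1 (N + (s + 1)), D t
      ≤ 2 * ∑ t ∈ Finset.Icc 1 (N + (s + 1)), c t
        + 2 * s * G * ∑ t ∈ Finset.Icc 1 (N + (s + 1)), κ t + 3 * (s + 1) * C + 2 * A := by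
  have hdrift : ∑ t ∈ Finset.Icc 1 N, ∑ i ∈ Finset.range s, κ (t + 1 + i)
      ≤ s * ∑ t ∈ Finset.Icc 1 (N + (s + 1)), κ t := by
    rw [Finset.sum_comm]
    refine (Finset.sum_le_card_nsmul _ _ _ fun i hi => ?_).trans_eq
      (by rw [Finset.card_range, nsmul_eq_mul])
    have hi' := Finset.mem_range.1 hi
    have h1 := sum_Icc_one_add κ N (1 + i)
    have h2 : 0 ≤ ∑ t ∈ Finset.Icc 1 (1 + i), κ t :=
      Finset.sum_nonneg fun t ht => hκ t (Finset.mem_Icc.1 ht).1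
    have h3 : ∑ t ∈ Finset.Icc 1 (N + (1 + i)), κ t ≤ ∑ t ∈ Finset.Icc 1 (N + (s + 1)), κ t :=
      Finset.sum_le_sum_of_subset_of_nonneg (Finset.Icc_subset_Icc_right (by omega))
        fun t ht _ => hκ t (Finset.mem_Icc.1 ht).1
    simp only [← add_assoc] at h1 h2 h3 ⊢
    linarith
  have hysum : ∑ t ∈ Finset.Icc 1 N, y t ≤ ∑ t ∈ Finset.Icc 1 N, c (t + (s + 1))
      + G * ∑ t ∈ Finset.Icc 1 N, ∑ i ∈ Finset.range s, κ (t + 1 + i) := by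
    rw [Finset.mul_sum, ← Finset.sum_add_distrib]
    exact Finset.sum_le_sum fun t ht => hy t (Finset.mem_Icc.1 ht).1
  have hc0 : (s + 1 : ℝ) * -C ≤ ∑ t ∈ Finset.Icc 1 (s + 1), c t := by
    have := Finset.card_nsmul_le_sum (Finset.Icc 1 (s + 1)) c (-C)
      fun t ht => hc t (Finset.mem_Icc.1 ht).1
    simpa using this
  have hDtail : ∑ t ∈ Finset.Icc 1 s, D (t + (N + 1)) ≤ s * C := by
    have := Finset.sum_le_card_nsmul (Finset.Icc 1 s) (fun t => D (t + (N + 1))) C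
      fun t _ => hD _ (by omega)
    simpa using this
  have h1 := sum_Icc_one_add c N (s + 1)
  have h2 := sum_Icc_one_add D N 1
  have h3 := sum_Icc_one_add D s (N + 1)
  rw [show s + (N + 1) = N + (s + 1) by ring] at h3
  rw [Finset.Icc_self, Finset.sum_singleton] at h2
  rw [Finset.sum_sub_distrib, ← Finset.sum_div] at hA
  have h4 := mul_le_mul_of_nonneg_left hdrift hG
  have h5 := hD 1 le_rfl
  nlinarith

/-! ### The bound for a fixed delay -/

lemma IsStable.nonneg {Ω E : Type*} [MeasurableSpace Ω] [NormedAddCommGroup E]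
    {μ : Measure Ω} [IsProbabilityMeasure μ] {w : ℕ → Ω → E} {κ : ℕ → ℝ}
    (hκ : IsStable μ w κ) {t : ℕ} (ht : 1 ≤ t) : 0 ≤ κ t := by
  obtain ⟨ω, hω⟩ := (hκ.norm_sub_le t ht).exists
  exact (norm_nonneg _).trans hω

lemma measure_setOf_mono_ae {Ω : Type*} [MeasurableSpace Ω] {μ : Measure Ω} {p q : Ω → Prop}
    (h : ∀ᵐ ω ∂μ, p ω → q ω) : μ {ω | p ω} ≤ μ {ω | q ω} :=
  measure_mono_ae h

section FixedDelay

variable {Ω Ξ E : Type*} [MeasurableSpace Ξ]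
  [NormedAddCommGroup E] [NormedSpace ℝ E]

lemma risk_avgPredictor_le {W : Set E} {F : E → Ξ → ℝ} {π : Measure Ξ} {w : ℕ → Ω → E}
    (hconv : ConvexOn ℝ W (risk F π)) (hw : ∀ t, 1 ≤ t → ∀ ω, w t ω ∈ W) {n : ℕ} (hn : 1 ≤ n)
    (ω : Ω) :
    risk F π (avgPredictor w n ω) ≤ 1 / (n : ℝ) * ∑ t ∈ Finset.Icc 1 n, risk F π (w t ω) := by
  have hn0 : (n : ℝ) ≠ 0 := by positivity
  have h := hconv.map_sum_le (t := Finset.Icc 1 n) (w := fun _ => 1 / (n : ℝ))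
    (p := fun t => w t ω) (fun _ _ => by positivity) (by simp [hn0])
    fun t ht => hw t (Finset.mem_Icc.1 ht).1 ω
  rw [avgPredictor, Finset.smul_sum, Finset.mul_sum]
  exact h

lemma avgPredictor_mem {W : Set E} {w : ℕ → Ω → E} (hW : Convex ℝ W)
    (hw : ∀ t, 1 ≤ t → ∀ ω, w t ω ∈ W) {n : ℕ} (hn : 1 ≤ n) (ω : Ω) :
    avgPredictor w n ω ∈ W := by
  have hn0 : (n : ℝ) ≠ 0 := by positivity
  have h := hW.sum_mem (t := Finset.Icc 1 n) (w := fun _ => 1 / (n : ℝ))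
    (z := fun t => w t ω) (fun _ _ => by positivity) (by simp [hn0])
    fun t ht => hw t (Finset.mem_Icc.1 ht).1 ω
  rw [avgPredictor, Finset.smul_sum]
  exact h

/-- The part of the bound that does not depend on the sample. -/
noncomputable def delayBound (G R σ δ : ℝ) (κ β : ℕ → ℝ) (n τ : ℕ) : ℝ :=
  2 * ((τ : ℝ) - 1) * G / n * (∑ t ∈ Finset.Icc 1 n, κ t + 2 * R)
    + 32 * G ^ 2 * τ / (σ * n) * Real.log (τ / δ)
    + 12 * τ * R * G / n * Real.log (2 * τ / δ)
    + 2 * R * G * β τ / δ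

lemma log_delay_nonneg {δ : ℝ} (hδ : 0 < δ) (hδe : δ < 1 / Real.exp 1) {τ : ℕ} (hτ : 1 ≤ τ) :
    0 ≤ Real.log (τ / δ) := by
  have hτ' : (1 : ℝ) ≤ τ := by exact_mod_cast hτ
  have he : δ ≤ 1 := hδe.le.trans (by
    rw [div_le_one (Real.exp_pos 1)]; exact Real.one_le_exp zero_le_one)
  exact Real.log_nonneg ((one_le_div hδ).2 (he.trans hτ'))

lemma one_le_log_two_mul_delay {δ : ℝ} (hδ : 0 < δ) (hδe : δ < 1 / Real.exp 1) {τ : ℕ}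
    (hτ : 1 ≤ τ) : 1 ≤ Real.log (2 * τ / δ) := by
  have hτ' : (1 : ℝ) ≤ τ := by exact_mod_cast hτ
  rw [Real.le_log_iff_exp_le (by positivity), le_div_iff₀ hδ]
  rw [lt_div_iff₀ (Real.exp_pos 1)] at hδe
  linarith

variable [MeasurableSpace Ω] [MeasurableSpace E]

/-- If the delay is at least `n`, or if `G = 0`, the bound holds almost surely, by
boundedness of the loss alone. -/
lemma ae_excess_risk_le_of_trivial
    {μ : Measure Ω} [IsProbabilityMeasure μ] {ξ : ℕ → Ω → Ξ}
    {π : Measure Ξ} [IsProbabilityMeasure π]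
    {W : Set E} {F : E → Ξ → ℝ} {G R σ : ℝ} (hG : 0 ≤ G) (hσ : 0 < σ)
    (hF : RegularLoss W F G R)
    {w : ℕ → Ω → E} (hw : IsOnlineAlgorithm W ξ w) {κ β : ℕ → ℝ} (hκ : IsStable μ w κ)
    (hβ : ∀ k, 0 ≤ β k) {n : ℕ} (hn : 1 ≤ n)
    {Reg : Ω → ℝ} (hReg : IsRegretBound μ W F ξ w n Reg)
    {wstar : E} (hwstar : wstar ∈ W) {δ : ℝ} (hδ : 0 < δ) (hδe : δ < 1 / Real.exp 1)
    {τ : ℕ} (hτ : 1 ≤ τ) (htriv : G = 0 ∨ n ≤ τ) :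
    ∀ᵐ ω ∂μ, risk F π (avgPredictor w n ω) - risk F π wstar
      ≤ 2 / (n : ℝ) * Reg ω + delayBound G R σ δ κ β n τ := by
  have hR : 0 ≤ R := (norm_nonneg _).trans (hF.norm_sub_le _ hwstar _ hwstar)
  have hn0 : (0 : ℝ) < n := by positivity
  have hτ1 : (0 : ℝ) ≤ (τ : ℝ) - 1 := sub_nonneg.2 (by exact_mod_cast hτ)
  have hlog1 := log_delay_nonneg hδ hδe hτ
  have hlog2 := one_le_log_two_mul_delay hδ hδe hτ
  have hκs : 0 ≤ ∑ t ∈ Finset.Icc 1 n, κ t :=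
    Finset.sum_nonneg fun t ht => hκ.nonneg (Finset.mem_Icc.1 ht).1
  have hB : 3 * (G * R) ≤ delayBound G R σ δ κ β n τ := by
    have h1 : 0 ≤ 2 * ((τ : ℝ) - 1) * G / n * (∑ t ∈ Finset.Icc 1 n, κ t + 2 * R) := by positivity
    have h2 : 0 ≤ 32 * G ^ 2 * τ / (σ * n) * Real.log (τ / δ) := by positivity
    have h3 : 0 ≤ 2 * R * G * β τ / δ :=
      div_nonneg (mul_nonneg (by positivity) (hβ τ)) hδ.le
    have h4 : 3 * (G * R) ≤ 12 * τ * R * G / n * Real.log (2 * τ / δ) := by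
      rcases htriv with rfl | hnτ
      · simp
      · have h5 : (n : ℝ) ≤ τ := by exact_mod_cast hnτ
        calc 3 * (G * R) ≤ 12 * τ * R * G / n := by
              rw [le_div_iff₀ hn0]
              nlinarith [mul_nonneg hG hR, mul_le_mul_of_nonneg_left h5 (mul_nonneg hG hR)]
          _ ≤ _ := le_mul_of_one_le_right (by positivity) hlog2
    unfold delayBound
    linarith
  filter_upwards [hReg wstar hwstar] with ω hω
  obtain ⟨x₀⟩ := nonempty_of_isProbabilityMeasure π
  have h1 := (hF.risk_mem_Icc π (avgPredictor_mem (hF.convex x₀).1 hw.mem hn ω)).2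
  have h2 := (hF.risk_mem_Icc π hwstar).1
  have h3 : (n : ℝ) * -(G * R) ≤ Reg ω := by
    refine le_trans ?_ hω
    have := Finset.card_nsmul_le_sum (Finset.Icc 1 n)
      (fun t => F (w t ω) (ξ t ω) - F wstar (ξ t ω)) (-(G * R)) fun t ht => by
        have h4 := (hF.mem_Icc (ξ t ω) _ (hw.mem t (Finset.mem_Icc.1 ht).1 ω)).1
        have h5 := (hF.mem_Icc (ξ t ω) _ hwstar).2
        linarith
    simpa using this
  have h4 : -(2 * (G * R)) ≤ 2 / (n : ℝ) * Reg ω := by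
    rw [div_mul_eq_mul_div, le_div_iff₀ hn0]
    linarith
  linarith

/-- By quadratic growth the exponential moment bound at parameter `σ / (2 G²)` loses only half of
the excess risk, which accounts for the factor `2` in front of the regret. -/
lemma measure_delayBound_lt_le [BorelSpace E]
    {μ : Measure Ω} [IsProbabilityMeasure μ] {ξ : ℕ → Ω → Ξ}
    (hξ : ∀ t, 1 ≤ t → Measurable (ξ t))
    {P : (t : ℕ) → ℕ → Kernel (Fin t → Ξ) Ξ} [∀ t k, IsMarkovKernel (P t k)]
    (hP : ∀ t k, 1 ≤ t → 1 ≤ k → HasCondDistrib (ξ (t + k)) (past ξ t) (P t k) μ)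
    {π : Measure Ξ} [IsProbabilityMeasure π]
    {W : Set E} {F : E → Ξ → ℝ} {G R σ : ℝ} (hG : 0 ≤ G) (hσ : 0 < σ)
    (hF : RegularLoss W F G R) (hf : IsStronglyConvex W (risk F π) σ)
    {w : ℕ → Ω → E} (hw : IsOnlineAlgorithm W ξ w) {κ : ℕ → ℝ} (hκ : IsStable μ w κ)
    {n : ℕ} (hn : 1 ≤ n)
    {Reg : Ω → ℝ} (hReg : IsRegretBound μ W F ξ w n Reg)
    {wstar : E} (hwstar : wstar ∈ W) (hmin : IsMinOn (risk F π) W wstar)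
    {δ : ℝ} (hδ : 0 < δ) (hδe : δ < 1 / Real.exp 1) {τ : ℕ} (hτ : 1 ≤ τ) :
    μ {ω | 2 / (n : ℝ) * Reg ω + delayBound G R σ δ κ (betaMixing μ ξ P π) n τ
      < risk F π (avgPredictor w n ω) - risk F π wstar} ≤ ENNReal.ofReal (2 * δ) := by
  have hβ : ∀ k, 0 ≤ betaMixing μ ξ P π k := fun k => ENNReal.toReal_nonneg
  by_cases htriv : G = 0 ∨ n ≤ τ
  · have h := ae_excess_risk_le_of_trivial (π := π) hG hσ hF hw hκ hβ hn hReg hwstar hδ hδe hτ htriv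
    simp only [ae_iff, not_le] at h
    exact h.trans_le zero_le
  obtain ⟨hG0, hnτ⟩ := not_or.1 htriv
  have hGpos : 0 < G := lt_of_le_of_ne hG (Ne.symm hG0)
  have hR : 0 ≤ R := (norm_nonneg _).trans (hF.norm_sub_le _ hwstar _ hwstar)
  obtain ⟨s, rfl⟩ : ∃ s, τ = s + 1 := ⟨τ - 1, by omega⟩
  obtain ⟨N, rfl⟩ : ∃ N, n = N + (s + 1) := ⟨n - (s + 1), by omega⟩
  have hdev := measure_excess_risk_deviation_le μ hξ P hP π hG hF hw hwstar hτ N hδ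
    (l := σ / (2 * G ^ 2)) (by positivity)
  refine le_trans (measure_setOf_mono_ae ?_) hdev
  filter_upwards [hReg wstar hwstar, ae_all_iff.2 fun t => ae_all_iff.2 (hκ.norm_sub_le t)]
    with ω hω hκω hbad
  by_contra! hgood
  refine absurd hbad (not_lt.2 ?_)
  set A := ((s + 1 : ℕ) : ℝ) * Real.log ((s + 1 : ℕ) / δ) / (σ / (2 * G ^ 2))
    + N * (G * R * betaMixing μ ξ P π (s + 1)) / δ with hAdef
  have hsum := sum_le_of_delayed_losses (C := G * R) (G := G) (A := A) (κ := κ)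
    (D := fun t => risk F π (w t ω) - risk F π wstar)
    (c := fun t => F (w t ω) (ξ t ω) - F wstar (ξ t ω))
    (y := fun t => F (w (t + 1) ω) (ξ (t + (s + 1)) ω) - F wstar (ξ (t + (s + 1)) ω))
    (N := N) (s := s) hG (fun t ht => hκ.nonneg ht)
    (fun t ht => by
      have h1 := (hF.risk_mem_Icc π (hw.mem t ht ω)).2
      have h2 := (hF.risk_mem_Icc π hwstar).1
      linarith)
    (fun t ht => by
      have h1 := (hF.mem_Icc (ξ t ω) _ (hw.mem t ht ω)).1
      have h2 := (hF.mem_Icc (ξ t ω) _ hwstar).2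
      linarith)
    (fun t ht => by
      have h1 := (abs_le.1 (hF.lipschitz (ξ (t + (s + 1)) ω) _ (hw.mem (t + 1) (by omega) ω) _
        (hw.mem (t + (s + 1)) (by omega) ω))).2
      have h2 : ‖w (t + 1) ω - w (t + (s + 1)) ω‖ ≤ ∑ i ∈ Finset.range s, κ (t + 1 + i) := by
        rw [← dist_eq_norm, show t + (s + 1) = t + 1 + s by ring]
        refine dist_le_range_sum_of_dist_le (f := fun i => w (t + 1 + i) ω) s fun {k} _ => ?_
        rw [dist_eq_norm]
        exact hκω (t + 1 + k) (by omega)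
      have h3 := mul_le_mul_of_nonneg_left h2 hG
      linarith)
    (by
      refine le_trans (Finset.sum_le_sum fun t _ => ?_) hgood
      have h1 := hf.sq_norm_sub_le hwstar hmin (hw.mem (t + 1) (by omega) ω)
      have h2 : σ / (2 * G ^ 2) * G ^ 2 * ‖w (t + 1) ω - wstar‖ ^ 2 / 2
          = (σ / 2 * ‖w (t + 1) ω - wstar‖ ^ 2) / 2 := by
        field_simp
      rw [h2]
      linarith)
  set n := N + (s + 1) with hndef
  have hn0 : (0 : ℝ) < n := by positivity
  obtain ⟨x₀⟩ := nonempty_of_isProbabilityMeasure π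
  have havg := risk_avgPredictor_le (hF.convexOn_risk π) hw.mem hn ω
  rw [Finset.sum_sub_distrib, Finset.sum_const, Nat.card_Icc, nsmul_eq_mul,
    Nat.add_sub_cancel] at hsum
  have hlog1 := log_delay_nonneg hδ hδe hτ
  have hlog2 := one_le_log_two_mul_delay hδ hδe hτ
  have hNn : (N : ℝ) ≤ n := by exact_mod_cast (by omega : N ≤ n)
  have hs0 : (0 : ℝ) ≤ s := by positivity
  have hcast : ((s + 1 : ℕ) : ℝ) = s + 1 := by push_cast; ring
  rw [hcast] at hAdef hlog1 hlog2
  have hA1 : (s + 1 : ℝ) * Real.log ((s + 1) / δ) / (σ / (2 * G ^ 2))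
      = 2 * (G ^ 2 * (s + 1) / σ * Real.log ((s + 1) / δ)) := by
    field_simp
  have hA2 : N * (G * R * betaMixing μ ξ P π (s + 1)) / δ
      ≤ n * (R * G * betaMixing μ ξ P π (s + 1) / δ) := by
    rw [mul_div_assoc, mul_comm G R]
    exact mul_le_mul_of_nonneg_right hNn
      (div_nonneg (mul_nonneg (mul_nonneg hR hG) (hβ _)) hδ.le)
  have hA3 : 0 ≤ G ^ 2 * (s + 1) / σ * Real.log ((s + 1) / δ) := by positivity
  have hA4 : (s + 1) * (G * R) ≤ (s + 1) * (G * R) * Real.log (2 * (s + 1) / δ) :=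
    le_mul_of_one_le_right (by positivity) hlog2
  have hA5 : 0 ≤ s * (G * R) := by positivity
  have hexpand : (n : ℝ) * (2 / (n : ℝ) * Reg ω
        + delayBound G R σ δ κ (betaMixing μ ξ P π) n (s + 1))
      = 2 * Reg ω + 2 * s * G * ∑ t ∈ Finset.Icc 1 n, κ t + 4 * (s * (G * R))
        + 32 * (G ^ 2 * (s + 1) / σ * Real.log ((s + 1) / δ))
        + 12 * ((s + 1) * (G * R) * Real.log (2 * (s + 1) / δ))
        + 2 * (n * (R * G * betaMixing μ ξ P π (s + 1) / δ)) := by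
    unfold delayBound
    rw [hcast]
    field_simp
    ring
  rw [← mul_le_mul_iff_right₀ hn0, hexpand]
  have havg' : n * (risk F π (avgPredictor w n ω) - risk F π wstar)
      ≤ ∑ t ∈ Finset.Icc 1 n, risk F π (w t ω) - n * risk F π wstar := by
    have := mul_le_mul_of_nonneg_left havg hn0.le
    rw [← mul_assoc, mul_one_div_cancel hn0.ne', one_mul] at this
    linarith
  have hA6 : 0 ≤ (s + 1) * (G * R) := by positivity
  linarith

end FixedDelay

/-! ### Uniformity in the delay -/

/-- Upper level sets of one function are nested, so that a bound on the probability of exceeding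
each single threshold is a bound on the probability of exceeding any of them. -/
lemma measure_exists_lt_le {Ω ι : Type*} [MeasurableSpace Ω] [Countable ι] {μ : Measure Ω}
    (X : Ω → ℝ) (b : ι → ℝ) {ε : ENNReal} (h : ∀ i, μ {ω | b i < X ω} ≤ ε) :
    μ {ω | ∃ i, b i < X ω} ≤ ε := by
  have hdir : Directed (· ⊆ ·) fun i => {ω | b i < X ω} := by
    intro i j
    rcases le_total (b i) (b j) with hij | hij
    · exact ⟨i, subset_rfl, fun ω hω => lt_of_le_of_lt hij hω⟩
    · exact ⟨j, fun ω hω => lt_of_le_of_lt hij hω, subset_rfl⟩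
  rw [Set.ofPred_exists, hdir.measure_iUnion]
  exact iSup_le h

end OnlineMixing

theorem mainTheorem4
    {Ω Ξ E : Type*} [MeasurableSpace Ω] [MeasurableSpace Ξ]
    [NormedAddCommGroup E] [NormedSpace ℝ E] [MeasurableSpace E] [BorelSpace E]
    -- the sample process, its conditional distributions, and the stationary distribution
    (μ : Measure Ω) [IsProbabilityMeasure μ]
    (ξ : ℕ → Ω → Ξ) (hξ : ∀ t, 1 ≤ t → Measurable (ξ t))
    (P : (t : ℕ) → ℕ → Kernel (Fin t → Ξ) Ξ) [∀ t k, IsMarkovKernel (P t k)]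
    (hP : ∀ t k, 1 ≤ t → 1 ≤ k →
      HasCondDistrib (ξ (t + k)) (OnlineMixing.past ξ t) (P t k) μ)
    (π : Measure Ξ) [IsProbabilityMeasure π]
    (ν : Measure Ξ) (hξν : ∀ t, 1 ≤ t → μ.map (ξ t) ≪ ν) (hπν : π ≪ ν)
    -- the loss and its assumptions
    (W : Set E) (F : E → Ξ → ℝ) (G R σ : ℝ) (hG : 0 ≤ G) (hσ : 0 < σ)
    (hF : OnlineMixing.BoundedLoss W F ν G R)
    (hf : OnlineMixing.IsStronglyConvex W (OnlineMixing.risk F π) σ)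
    -- the online algorithm
    (w : ℕ → Ω → E) (hw : OnlineMixing.IsOnlineAlgorithm W ξ w)
    (κ : ℕ → ℝ) (hκ : OnlineMixing.IsStable μ w κ)
    (n : ℕ) (hn : 3 ≤ n)
    (Reg : Ω → ℝ) (hRegm : AEMeasurable Reg μ)
    (hReg : OnlineMixing.IsRegretBound μ W F ξ w n Reg)
    -- the minimizer of the risk
    (wstar : E) (hwstar : wstar ∈ W) (hmin : IsMinOn (OnlineMixing.risk F π) W wstar)
    (δ : ℝ) (hδ : 0 < δ) (hδe : δ < 1 / Real.exp 1) :
    1 - 5 * δ * Real.log n <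
      μ.real {ω | ∀ τ : ℕ, 1 ≤ τ →
        OnlineMixing.risk F π (OnlineMixing.avgPredictor w n ω) - OnlineMixing.risk F π wstar ≤
          2 / (n : ℝ) * Reg ω
          + 2 * ((τ : ℝ) - 1) * G / n * (∑ t ∈ Finset.Icc 1 n, κ t + 2 * R)
          + 32 * G ^ 2 * τ / (σ * n) * Real.log (τ / δ)
          + 12 * τ * R * G / n * Real.log (2 * τ / δ)
          + 2 * R * G * OnlineMixing.betaMixing μ ξ P π τ / δ} := by
  have hν : ν ≠ 0 := fun h =>
    IsProbabilityMeasure.ne_zero π (Measure.absolutelyContinuous_zero_iff.1 (h ▸ hπν))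
  obtain ⟨F', hF', hFF'⟩ := hF.exists_regularLoss hG hν
  have hrisk : OnlineMixing.risk F π = OnlineMixing.risk F' π := by
    funext v
    refine integral_congr_ae ?_
    filter_upwards [hπν.ae_le hFF'] with x hx
    exact (hx v).symm
  have hReg' : OnlineMixing.IsRegretBound μ W F' ξ w n Reg := by
    have hξF : ∀ᵐ ω ∂μ, ∀ t, 1 ≤ t → ∀ v, F' v (ξ t ω) = F v (ξ t ω) :=
      ae_all_iff.2 fun t => ae_all_iff.2 fun ht =>
        ae_of_ae_map (hξ t ht).aemeasurable ((hξν t ht).ae_le hFF')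
    intro v hv
    filter_upwards [hReg v hv, hξF] with ω hω hωF
    refine le_trans (le_of_eq (Finset.sum_congr rfl fun t ht => ?_)) hω
    rw [hωF t (Finset.mem_Icc.1 ht).1, hωF t (Finset.mem_Icc.1 ht).1]
  rw [hrisk] at hf hmin ⊢
  let X : Ω → ℝ := fun ω => OnlineMixing.risk F' π (OnlineMixing.avgPredictor w n ω)
    - OnlineMixing.risk F' π wstar - 2 / (n : ℝ) * Reg ω
  let b : {τ : ℕ // 1 ≤ τ} → ℝ := fun τ =>
    OnlineMixing.delayBound G R σ δ κ (OnlineMixing.betaMixing μ ξ P π) n τ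
  have hbad : μ {ω | ∃ τ, b τ < X ω} ≤ ENNReal.ofReal (2 * δ) := by
    refine OnlineMixing.measure_exists_lt_le X b fun τ => ?_
    refine le_trans (measure_mono fun ω hω => ?_) (OnlineMixing.measure_delayBound_lt_le hξ hP hG
      hσ hF' hf hw hκ (by omega) hReg' hwstar hmin hδ hδe τ.2)
    exact lt_sub_iff_add_lt'.1 (Set.mem_ofPred.1 hω)
  set S := {ω | ∃ τ, b τ < X ω} with hS
  -- subadditivity needs no measurability of the event
  have hcompl : 1 ≤ μ.real Sᶜ + μ.real S := by
    have h := measureReal_union_le (μ := μ) Sᶜ S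
    rwa [Set.compl_union_self, probReal_univ] at h
  have hSreal : μ.real S ≤ 2 * δ := ENNReal.toReal_le_of_le_ofReal (by positivity) hbad
  have hlog : 1 < Real.log n := by
    rw [Real.lt_log_iff_exp_lt (by positivity)]
    exact Real.exp_one_lt_three.trans_le (by exact_mod_cast hn)
  have hlt : 1 - 5 * δ * Real.log n < μ.real Sᶜ := by
    nlinarith [mul_lt_mul_of_pos_left hlog hδ]
  refine hlt.trans_le (measureReal_mono fun ω hω τ hτ => ?_)
  have h : X ω ≤ b ⟨τ, hτ⟩ := not_lt.1 fun hlt => hω ⟨⟨τ, hτ⟩, hlt⟩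
  simp only [X, b, OnlineMixing.delayBound] at h
  linarith
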